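/- Let $r\ge 1$ and $n\ge 0$ be integers and let $A_k,B_k,C_k,D_k\in\mathbb C^{n\times n}$ for $k=1,\dots,r$. Indices are taken modulo $r$, so that $X_{r+1}=X_1$. The periodic system of generalized Sylvester equations $$A_kX_kB_k-C_kX_{k+1}D_k=E_k,\qquad k=1,\dots,r,$$ is called nonsingular if for every choice of $E_1,\dots,E_r\in\mathbb C^{n\times n}$ it has exactly one solution $(X_1,\dots,X_r)\in(\mathbb C^{n\times n})^r$. For matrices $M_k,N_k\in\mathbb C^{n\times n}$ ($k=1,\dots,r$; the $N_k$ need not be invertible), a formal periodic Schur form of the formal matrix product $N_r^{-1}M_rN_{r-1}^{-1}M_{r-1}\cdots N_1^{-1}M_1$, or of the formal matrix product $M_rN_{r-1}^{-1}M_{r-1}\cdots N_1^{-1}M_1N_r^{-1}$, consists of upper triangular matrices $T_k=Q_k^{\mathsf H}M_kZ_k$ and $R_k=Q_k^{\mathsf H}N_kZ_{k+1}$, $k=1,\dots,r$, with $Q_k,Z_k$ unitary and $Z_{r+1}=Z_1$. The formal product is regular if it has such a form in which, for every $i\in\{1,\dots,n\}$, the numbers $\prod_{k=1}^r(T_k)_{ii}$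 and $\prod_{k=1}^r(R_k)_{ii}$ are not both zero. The spectrum of a regular formal product is the set of its eigenvalues $$\lambda_i=\frac{\prod_{k=1}^r(T_k)_{ii}}{\prod_{k=1}^r(R_k)_{ii}}\in\mathbb C\cup\{\infty\},\qquad i=1,\dots,n,$$ where $a/0=\infty$ for $a\ne0$. (Such a form always exists, and regularity and spectrum do not depend on which form is used.) Theorem. The periodic system above is nonsingular if and only if the two formal matrix products $$C_r^{-1}A_rC_{r-1}^{-1}A_{r-1}\cdots C_1^{-1}A_1\qquad\text{and}\qquad D_rB_r^{-1}D_{r-1}B_{r-1}^{-1}\cdots D_1B_1^{-1}$$ are both regular and their spectra are disjoint. -/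

import Mathlib

/-- A formal matrix product with `r` numerator factors `M_k` and `r` denominator factors `N_k`,
indexed cyclically by `Fin r` (so that `k + 1` means `k + 1` modulo `r`).  The data stand for
`N_r⁻¹ M_r N_{r-1}⁻¹ M_{r-1} ⋯ N_1⁻¹ M_1`, or for its cyclic rotation
`M_r N_{r-1}⁻¹ M_{r-1} ⋯ N_1⁻¹ M_1 N_r⁻¹`; regularity and eigenvalues of both are given by the
same formulas.  No factor is required to be invertible. -/
structure FormalProduct (r n : ℕ) where
  /-- the factors `M_k` (exponent `1`) -/
  M : Fin r → Matrix (Fin n) (Fin n) ℂ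
  /-- the factors `N_k` (exponent `-1`) -/
  N : Fin r → Matrix (Fin n) (Fin n) ℂ

namespace FormalProduct

/-- The formal product `N_r⁻¹ M_r N_{r-1}⁻¹ M_{r-1} ⋯ N_1⁻¹ M_1`. -/
def invMul {r n : ℕ} (N M : Fin r → Matrix (Fin n) (Fin n) ℂ) : FormalProduct r n :=
  ⟨M, N⟩

/-- The formal product `M_r N_r⁻¹ M_{r-1} N_{r-1}⁻¹ ⋯ M_1 N_1⁻¹`.  The inverted factor that stands
between `M_{k+1}` and `M_k` is `N_{k+1}`, and the last one (to the right of `M_1`) is `N_1`, so the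
`k`-th denominator factor in the sense of `FormalProduct` is `N_{k+1}` (indices modulo `r`). -/
def mulInv {r n : ℕ} [NeZero r] (M N : Fin r → Matrix (Fin n) (Fin n) ℂ) : FormalProduct r n :=
  ⟨M, fun k => N (k + 1)⟩

/-- `(T, R)` is a formal periodic Schur form of `P`: there are unitary `Q_k`, `Z_k` such that
`T_k = Q_kᴴ M_k Z_k` and `R_k = Q_kᴴ N_k Z_{k+1}` are upper triangular, where `Z_{r+1} = Z_1`. -/
def IsPeriodicSchurForm {r n : ℕ} [NeZero r] (P : FormalProduct r n)
    (T R : Fin r → Matrix (Fin n) (Fin n) ℂ) : Prop :=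
  ∃ Q Z : Fin r → Matrix (Fin n) (Fin n) ℂ,
    (∀ k, Q k ∈ Matrix.unitaryGroup (Fin n) ℂ) ∧
    (∀ k, Z k ∈ Matrix.unitaryGroup (Fin n) ℂ) ∧
    (∀ k, (Q k).conjTranspose * P.M k * Z k = T k) ∧
    (∀ k, (Q k).conjTranspose * P.N k * Z (k + 1) = R k) ∧
    (∀ k, (T k).BlockTriangular id) ∧
    (∀ k, (R k).BlockTriangular id)

/-- `P` is regular: in a formal periodic Schur form of `P` (which one does not matter), the two
products `∏ k, (T_k)_{ii}` and `∏ k, (R_k)_{ii}` do not both vanish, for any `i`. -/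
def IsRegular {r n : ℕ} [NeZero r] (P : FormalProduct r n) : Prop :=
  ∃ T R : Fin r → Matrix (Fin n) (Fin n) ℂ, P.IsPeriodicSchurForm T R ∧
    ∀ i, ¬ (∏ k, T k i i = 0 ∧ ∏ k, R k i i = 0)

open Classical in
/-- The ratio `a / b` in `ℂ ∪ {∞}`, with `a / 0 = ∞` (only meant for `(a, b) ≠ (0, 0)`). -/
noncomputable def ratio (a b : ℂ) : OnePoint ℂ :=
  if b = 0 then OnePoint.infty else ((a / b : ℂ) : OnePoint ℂ)

/-- The spectrum of a (regular) formal product: the set of its eigenvalues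
`λ_i = ∏ k, (T_k)_{ii} / ∏ k, (R_k)_{ii} ∈ ℂ ∪ {∞}`, computed from a formal periodic Schur form
(which one does not matter). -/
def spectrum {r n : ℕ} [NeZero r] (P : FormalProduct r n) : Set (OnePoint ℂ) :=
  {z | ∃ T R : Fin r → Matrix (Fin n) (Fin n) ℂ, P.IsPeriodicSchurForm T R ∧
    ∃ i, z = ratio (∏ k, T k i i) (∏ k, R k i i)}

end FormalProduct

/-- The periodic system `A_k X_k B_k - C_k X_{k+1} D_k = E_k` (`X_{r+1} = X_1`) is nonsingular:
it has exactly one solution for every right-hand side. -/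
def PeriodicSylvesterNonsingular {r n : ℕ} [NeZero r]
    (A B C D : Fin r → Matrix (Fin n) (Fin n) ℂ) : Prop :=
  ∀ E : Fin r → Matrix (Fin n) (Fin n) ℂ, ∃! X : Fin r → Matrix (Fin n) (Fin n) ℂ,
    ∀ k, A k * X k * B k - C k * X (k + 1) * D k = E k

/-!
Every formal product has a cyclic chain of one-dimensional deflating subspaces: if all factors are
invertible it comes from an eigenvector, and otherwise it is propagated once around the cycle from
the kernel of a singular factor. Splitting off such chains one after another gives a periodic Schur
form. Unitary changes of variables therefore reduce the periodic Sylvester system to triangular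
coefficients. Its matrix with respect to `vec` is then block triangular with one `r × r` diagonal
block per entry `(i, j)` of the unknowns. That block is cyclic bidiagonal, and expanding its
determinant leaves the difference of two products only,
`∏ (A_k)_ii (B_k)_jj - ∏ (C_k)_ii (D_k)_jj`. All these differences are nonzero exactly if no
eigenvalue of either product is `0 / 0` and the two spectra share no ratio.
-/

open Matrix
open scoped Kronecker

section CyclicChain

variable {r : ℕ} [NeZero r]

theorem forall_of_cyclic_step {p : Fin r → Prop} (hp : ∀ k, p k → p (k + 1)) {k₀ : Fin r}
    (h₀ : p k₀) (k : Fin r) : p k := by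
  obtain ⟨m, rfl⟩ := Nat.exists_eq_succ_of_ne_zero (NeZero.ne r)
  have key (j : Fin (m + 1)) : p (k₀ + j) := by
    induction j using Fin.induction with
    | zero => simpa using h₀
    | succ j ih =>
      rw [← Fin.coeSucc_eq_succ, ← add_assoc]
      exact hp _ ih
  simpa using key (k - k₀)

theorem exists_forward_cyclic_chain {V : Type*} {S : Fin r → V → V → Prop}
    (hS : ∀ k x, ∃ y, S k x y) (k₀ : Fin r) (x : V) :
    ∃ z : Fin r → V, z (k₀ + 1) = x ∧ ∀ k ≠ k₀, S k (z k) (z (k + 1)) := by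
  obtain ⟨m, rfl⟩ := Nat.exists_eq_succ_of_ne_zero (NeZero.ne r)
  choose f hf using hS
  let w : Fin (m + 1) → V := Fin.induction x fun j v => f (j.castSucc + (k₀ + 1)) v
  have hw (j : Fin m) : S (j.castSucc + (k₀ + 1)) (w j.castSucc) (w j.succ) := hf _ _
  refine ⟨fun k => w (k - (k₀ + 1)), by simp [w], fun k hk => ?_⟩
  obtain ⟨j, hj⟩ | hlast := Fin.eq_castSucc_or_eq_last (k - (k₀ + 1))
  · have hj' : k + 1 - (k₀ + 1) = j.succ := by
      rw [← Fin.coeSucc_eq_succ, ← hj]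
      abel
    have := hw j
    rwa [← hj, ← hj', sub_add_cancel] at this
  · refine absurd ?_ hk
    have : k - (k₀ + 1) + 1 = 0 := by rw [hlast, Fin.last_add_one]
    rwa [sub_add, add_sub_cancel_right, sub_eq_zero] at this

theorem exists_backward_cyclic_chain {V : Type*} {S : Fin r → V → V → Prop}
    (hS : ∀ k y, ∃ x, S k x y) (k₀ : Fin r) (y : V) :
    ∃ z : Fin r → V, z k₀ = y ∧ ∀ k ≠ k₀, S k (z k) (z (k + 1)) := by
  obtain ⟨z, hz, h⟩ :=
    exists_forward_cyclic_chain (S := fun k x y => S (-(k + 1)) y x) (fun k => hS _) (-(k₀ + 1)) y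
  refine ⟨fun k => z (-k), by simpa using hz, fun k hk => ?_⟩
  simpa using h (-(k + 1)) (by simpa using hk)

end CyclicChain

section DeflatingChain

variable {K V : Type*} [Field K] [AddCommGroup V] [Module K V]

/-- The lines spanned by `x` and `y` form one link of a chain of deflating subspaces of the pair
`(f, g)`: `f` maps the first and `g` the second into a common line. -/
def Deflates (f g : Module.End K V) (x y : V) : Prop :=
  ∃ q ≠ 0, f x ∈ K ∙ q ∧ g y ∈ K ∙ q

namespace Deflates

variable {f g : Module.End K V} {x y : V}

theorem symm (h : Deflates f g x y) : Deflates g f y x :=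
  h.imp fun _ ⟨hq, hf, hg⟩ => ⟨hq, hg, hf⟩

theorem of_apply_eq_smul (hx : x ≠ 0) {c : K} (h : g y = c • f x) : Deflates f g x y := by
  by_cases hfx : f x = 0
  · exact ⟨x, hx, by simp [hfx], by simp [h, hfx]⟩
  · exact ⟨f x, hfx, Submodule.mem_span_singleton_self _,
      h ▸ Submodule.smul_mem _ _ (Submodule.mem_span_singleton_self _)⟩

theorem of_apply_eq_zero (hx : x ≠ 0) (h : g y = 0) : Deflates f g x y :=
  of_apply_eq_smul hx (c := 0) (by simpa using h)

end Deflates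

variable [FiniteDimensional K V]

theorem exists_ne_zero_deflates (f g : Module.End K V) {x : V} (hx : x ≠ 0) :
    ∃ y ≠ 0, Deflates f g x y := by
  by_cases hg : Function.Injective g
  · obtain ⟨y, hy⟩ := LinearMap.surjective_of_injective hg (f x)
    by_cases hfx : f x = 0
    · exact ⟨x, hx, (Deflates.of_apply_eq_zero hx hfx).symm⟩
    · exact ⟨y, fun h => hfx (by rw [← hy, h, map_zero]),
        .of_apply_eq_smul hx (c := 1) (by rw [hy, one_smul])⟩
  · obtain ⟨y, hgy, hy⟩ : ∃ y, g y = 0 ∧ y ≠ 0 := by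
      simpa [injective_iff_map_eq_zero] using hg
    exact ⟨y, hy, .of_apply_eq_zero hx hgy⟩

variable {r : ℕ} [NeZero r] (f g : Fin r → Module.End K V)

theorem exists_deflating_chain_of_not_injective
    (h : ∃ k, ¬ Function.Injective (f k) ∨ ¬ Function.Injective (g k)) :
    ∃ z : Fin r → V, ∀ k, z k ≠ 0 ∧ Deflates (f k) (g k) (z k) (z (k + 1)) := by
  let S (k : Fin r) (x y : {v : V // v ≠ 0}) : Prop := Deflates (f k) (g k) x y
  suffices h : ∃ z : Fin r → {v : V // v ≠ 0}, ∀ k, S k (z k) (z (k + 1)) by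
    obtain ⟨z, hz⟩ := h
    exact ⟨fun k => z k, fun k => ⟨(z k).2, hz k⟩⟩
  simp only [injective_iff_map_eq_zero, not_forall, exists_prop] at h
  obtain ⟨k₀, ⟨v, hv, hv0⟩ | ⟨v, hv, hv0⟩⟩ := h
  · have hS k (y : {v : V // v ≠ 0}) : ∃ x, S k x y :=
      let ⟨x, hx, h⟩ := exists_ne_zero_deflates (g k) (f k) y.2
      ⟨⟨x, hx⟩, h.symm⟩
    obtain ⟨z, hz₀, hz⟩ := exists_backward_cyclic_chain hS k₀ ⟨v, hv0⟩
    refine ⟨z, fun k => ?_⟩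
    obtain rfl | hk := eq_or_ne k k₀
    · exact (Deflates.of_apply_eq_zero (z (k + 1)).2 (by rwa [hz₀])).symm
    · exact hz k hk
  · have hS k (x : {v : V // v ≠ 0}) : ∃ y, S k x y :=
      let ⟨y, hy, h⟩ := exists_ne_zero_deflates (f k) (g k) x.2
      ⟨⟨y, hy⟩, h⟩
    obtain ⟨z, hz₀, hz⟩ := exists_forward_cyclic_chain hS k₀ ⟨v, hv0⟩
    refine ⟨z, fun k => ?_⟩
    obtain rfl | hk := eq_or_ne k k₀
    · exact Deflates.of_apply_eq_zero (z k).2 (by rwa [hz₀])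
    · exact hz k hk

variable [IsAlgClosed K] [Nontrivial V]

theorem exists_deflating_chain_of_injective {f g : Fin r → Module.End K V}
    (hf : ∀ k, Function.Injective (f k)) (hg : ∀ k, Function.Injective (g k)) :
    ∃ z : Fin r → V, ∀ k, z k ≠ 0 ∧ Deflates (f k) (g k) (z k) (z (k + 1)) := by
  let shift : Module.End K (Fin r → V) := LinearMap.pi fun k =>
    ((LinearEquiv.ofInjectiveEndo (f k) (hf k)).symm : V →ₗ[K] V) ∘ₗ g k ∘ₗ LinearMap.proj (k + 1)
  obtain ⟨c, hc⟩ := Module.End.exists_eigenvalue shift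
  obtain ⟨z, hz⟩ := hc.exists_hasEigenvector
  have hgz (k : Fin r) : g k (z (k + 1)) = c • f k (z k) := by
    have := congrFun hz.apply_eq_smul k
    simpa [shift, LinearEquiv.symm_apply_eq] using this
  have hz0 (k : Fin r) : z k ≠ 0 := fun hk =>
    hz.2 <| funext <| forall_of_cyclic_step
      (p := fun j => z j = 0) (fun j hj => hg j (by simp [hgz, hj])) hk
  exact ⟨z, fun k => ⟨hz0 k, .of_apply_eq_smul (hz0 k) (hgz k)⟩⟩

theorem exists_deflating_chain :
    ∃ z : Fin r → V, ∀ k, z k ≠ 0 ∧ Deflates (f k) (g k) (z k) (z (k + 1)) := by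
  by_cases h : ∃ k, ¬ Function.Injective (f k) ∨ ¬ Function.Injective (g k)
  · exact exists_deflating_chain_of_not_injective f g h
  · simp only [not_exists, not_or, not_not] at h
    exact exists_deflating_chain_of_injective (fun k => (h k).1) fun k => (h k).2

end DeflatingChain

theorem exists_mem_unitaryGroup_span_col_eq {𝕜 ι : Type*} [RCLike 𝕜] [Fintype ι] [DecidableEq ι]
    (i₀ : ι) {v : ι → 𝕜} (hv : v ≠ 0) : ∃ U ∈ unitaryGroup ι 𝕜, 𝕜 ∙ U.col i₀ = 𝕜 ∙ v := by
  let w : EuclideanSpace 𝕜 ι := WithLp.toLp 2 v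
  have hw : w ≠ 0 := by simpa [w] using hv
  let c : 𝕜 := (‖w‖ : 𝕜)⁻¹
  have hc : c ≠ 0 := inv_ne_zero (by simpa using hw)
  have orthonormal_singleton : Orthonormal 𝕜 (({i₀} : Set ι).domRestrict fun _ => c • w) :=
    ⟨fun _ => norm_smul_inv_norm hw, fun i j hij => absurd (Subsingleton.elim i j) hij⟩
  obtain ⟨b, hb⟩ := orthonormal_singleton.exists_orthonormalBasis_extension_of_card_eq (by simp)
  refine ⟨(EuclideanSpace.basisFun ι 𝕜).toBasis.toMatrix b,
    OrthonormalBasis.toMatrix_orthonormalBasis_mem_unitary _ _, ?_⟩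
  have hcol : ((EuclideanSpace.basisFun ι 𝕜).toBasis.toMatrix b).col i₀ = c • v := by
    ext i
    simp [Module.Basis.toMatrix_apply, hb i₀ rfl, w]
  rw [hcol, Submodule.span_singleton_smul_eq hc.isUnit]

theorem conjTranspose_mul_mul_apply_eq_zero {R ι : Type*} [CommRing R] [StarRing R] [Fintype ι]
    [DecidableEq ι] {Q M Z : Matrix ι ι R} (hQ : Q ∈ unitaryGroup ι R) {i j : ι} (hij : i ≠ j)
    (h : M *ᵥ Z.col j ∈ R ∙ Q.col j) : (Qᴴ * M * Z) i j = 0 := by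
  obtain ⟨c, hc⟩ := Submodule.mem_span_singleton.mp h
  have hQ' : Qᴴ * Q = 1 := mem_unitaryGroup_iff'.mp hQ
  have hcol : (Qᴴ * M * Z).col j = c • Pi.single j 1 :=
    calc (Qᴴ * M * Z).col j
      _ = Qᴴ *ᵥ (M *ᵥ Z.col j) := by
        rw [← mulVec_single_one, ← mulVec_mulVec, ← mulVec_mulVec, mulVec_single_one]
      _ = c • Pi.single j 1 := by
        rw [← hc, mulVec_smul, ← mulVec_single_one, mulVec_mulVec, hQ', one_mulVec]
  simpa [hij] using congrFun hcol i

section OneCorner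

variable {R : Type*} [Semiring R] {n : ℕ}

/-- The block diagonal matrix `diag(1, U)`, which lets a transformation of the trailing
`n × n` block act on matrices of size `n + 1`. -/
def oneCorner (U : Matrix (Fin n) (Fin n) R) : Matrix (Fin (n + 1)) (Fin (n + 1)) R :=
  of (Fin.cons (Pi.single 0 1) fun i => Fin.cons 0 (U i))

@[simp]
theorem oneCorner_zero_zero (U : Matrix (Fin n) (Fin n) R) : oneCorner U 0 0 = 1 := by
  simp [oneCorner]

@[simp]
theorem oneCorner_zero_succ (U : Matrix (Fin n) (Fin n) R) (j : Fin n) :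
    oneCorner U 0 j.succ = 0 := by
  simp [oneCorner]

@[simp]
theorem oneCorner_succ_zero (U : Matrix (Fin n) (Fin n) R) (i : Fin n) :
    oneCorner U i.succ 0 = 0 := by
  simp [oneCorner]

@[simp]
theorem oneCorner_succ_succ (U : Matrix (Fin n) (Fin n) R) (i j : Fin n) :
    oneCorner U i.succ j.succ = U i j := by
  simp [oneCorner]

theorem oneCorner_one : oneCorner (1 : Matrix (Fin n) (Fin n) R) = 1 := by
  ext i j
  cases i using Fin.cases <;> cases j using Fin.cases <;>
    simp [one_apply, Fin.succ_ne_zero, (Fin.succ_ne_zero _).symm]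

theorem oneCorner_mul (U V : Matrix (Fin n) (Fin n) R) :
    oneCorner (U * V) = oneCorner U * oneCorner V := by
  ext i j
  cases i using Fin.cases <;> cases j using Fin.cases <;> simp [mul_apply, Fin.sum_univ_succ]

theorem blockTriangular_oneCorner_mul_mul {U V : Matrix (Fin n) (Fin n) R}
    {X : Matrix (Fin (n + 1)) (Fin (n + 1)) R} (hX : ∀ i : Fin n, X i.succ 0 = 0)
    (h : (U * X.submatrix Fin.succ Fin.succ * V).BlockTriangular id) :
    (oneCorner U * X * oneCorner V).BlockTriangular id := by
  intro i j hji
  cases i using Fin.cases with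
  | zero => exact absurd hji (Fin.not_lt_zero _)
  | succ i =>
    cases j using Fin.cases with
    | zero => simp [mul_apply, Fin.sum_univ_succ, hX]
    | succ j =>
      have := h (Fin.succ_lt_succ_iff.mp hji)
      simpa [mul_apply, Fin.sum_univ_succ] using this

theorem conjTranspose_oneCorner [StarRing R] (U : Matrix (Fin n) (Fin n) R) :
    (oneCorner U)ᴴ = oneCorner Uᴴ := by
  ext i j
  cases i using Fin.cases <;> cases j using Fin.cases <;> simp [conjTranspose_apply]

theorem oneCorner_mem_unitaryGroup {R : Type*} [CommRing R] [StarRing R]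
    {U : Matrix (Fin n) (Fin n) R} (hU : U ∈ unitaryGroup (Fin n) R) :
    oneCorner U ∈ unitaryGroup (Fin (n + 1)) R := by
  rw [mem_unitaryGroup_iff, star_eq_conjTranspose] at hU ⊢
  rw [conjTranspose_oneCorner, ← oneCorner_mul, hU, oneCorner_one]

end OneCorner

section PeriodicSchur

variable {r n : ℕ} [NeZero r]

theorem exists_unitary_first_col_eq_zero (M N : Fin r → Matrix (Fin (n + 1)) (Fin (n + 1)) ℂ) :
    ∃ Q Z : Fin r → Matrix (Fin (n + 1)) (Fin (n + 1)) ℂ,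
      (∀ k, Q k ∈ unitaryGroup _ ℂ) ∧ (∀ k, Z k ∈ unitaryGroup _ ℂ) ∧
      (∀ k i, ((Q k)ᴴ * M k * Z k) (Fin.succ i) 0 = 0) ∧
      (∀ k i, ((Q k)ᴴ * N k * Z (k + 1)) (Fin.succ i) 0 = 0) := by
  obtain ⟨z, hz⟩ := exists_deflating_chain (fun k => toLin' (M k)) (fun k => toLin' (N k))
  choose hz0 q hq hMq hNq using hz
  choose Z hZ hZz using fun k => exists_mem_unitaryGroup_span_col_eq 0 (hz0 k)
  choose Q hQ hQq using fun k => exists_mem_unitaryGroup_span_col_eq 0 (hq k)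
  have maps_col {X : Matrix (Fin (n + 1)) (Fin (n + 1)) ℂ} {k l : Fin r}
      (h : toLin' X (z l) ∈ ℂ ∙ q k) : X *ᵥ (Z l).col 0 ∈ ℂ ∙ (Q k).col 0 := by
    obtain ⟨c, hc⟩ := Submodule.mem_span_singleton.mp (hZz l ▸ Submodule.mem_span_singleton_self _)
    rw [hQq, ← hc, mulVec_smul]
    exact Submodule.smul_mem _ c h
  exact ⟨Q, Z, hQ, hZ,
    fun k i => conjTranspose_mul_mul_apply_eq_zero (hQ k) i.succ_ne_zero (maps_col (hMq k)),
    fun k i => conjTranspose_mul_mul_apply_eq_zero (hQ k) i.succ_ne_zero (maps_col (hNq k))⟩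

theorem exists_unitary_blockTriangular (M N : Fin r → Matrix (Fin n) (Fin n) ℂ) :
    ∃ Q Z : Fin r → Matrix (Fin n) (Fin n) ℂ,
      (∀ k, Q k ∈ unitaryGroup (Fin n) ℂ) ∧ (∀ k, Z k ∈ unitaryGroup (Fin n) ℂ) ∧
      (∀ k, ((Q k)ᴴ * M k * Z k).BlockTriangular id) ∧
      (∀ k, ((Q k)ᴴ * N k * Z (k + 1)).BlockTriangular id) := by
  induction n with
  | zero =>
    exact ⟨1, 1, fun _ => one_mem _, fun _ => one_mem _, fun _ i => i.elim0, fun _ i => i.elim0⟩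
  | succ n ih =>
    obtain ⟨Q, Z, hQ, hZ, hM, hN⟩ := exists_unitary_first_col_eq_zero M N
    obtain ⟨Q', Z', hQ', hZ', hM', hN'⟩ := ih
      (fun k => ((Q k)ᴴ * M k * Z k).submatrix Fin.succ Fin.succ)
      (fun k => ((Q k)ᴴ * N k * Z (k + 1)).submatrix Fin.succ Fin.succ)
    refine ⟨fun k => Q k * oneCorner (Q' k), fun k => Z k * oneCorner (Z' k),
      fun k => mul_mem (hQ k) (oneCorner_mem_unitaryGroup (hQ' k)),
      fun k => mul_mem (hZ k) (oneCorner_mem_unitaryGroup (hZ' k)), fun k => ?_, fun k => ?_⟩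
    · simpa only [conjTranspose_mul, conjTranspose_oneCorner, mul_assoc]
        using blockTriangular_oneCorner_mul_mul (hM k) (hM' k)
    · simpa only [conjTranspose_mul, conjTranspose_oneCorner, mul_assoc]
        using blockTriangular_oneCorner_mul_mul (hN k) (hN' k)

theorem FormalProduct.exists_isPeriodicSchurForm (P : FormalProduct r n) :
    ∃ T R, P.IsPeriodicSchurForm T R := by
  obtain ⟨Q, Z, hQ, hZ, hT, hR⟩ := exists_unitary_blockTriangular P.M P.N
  exact ⟨_, _, Q, Z, hQ, hZ, fun _ => rfl, fun _ => rfl, hT, hR⟩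

end PeriodicSchur

section CyclicBidiagonal

variable {R : Type*} [CommRing R] {r : ℕ} [NeZero r]

/-- The coefficient matrix of the cyclic system `a k * y k - b k * y (k + 1)`, with diagonal `a` and
cyclic superdiagonal `-b`. The two are superposed when `r = 1`, where `k + 1 = k`. -/
def cyclicBidiagonal (a b : Fin r → R) : Matrix (Fin r) (Fin r) R :=
  of fun k l => (if k = l then a k else 0) - if k + 1 = l then b k else 0

theorem cyclicBidiagonal_mulVec_apply (a b y : Fin r → R) (k : Fin r) :
    (cyclicBidiagonal a b *ᵥ y) k = a k * y k - b k * y (k + 1) := by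
  simp [cyclicBidiagonal, mulVec, dotProduct, sub_mul]

theorem det_cyclicBidiagonal (a b : Fin r → R) :
    (cyclicBidiagonal a b).det = ∏ k, a k - ∏ k, b k := by
  obtain ⟨m, rfl⟩ := Nat.exists_eq_succ_of_ne_zero (NeZero.ne r)
  have apply_zero (k : Fin (m + 1)) : cyclicBidiagonal a b k 0 =
      (if k = 0 then a k else 0) - if k = Fin.last m then b k else 0 := by
    simp only [cyclicBidiagonal, of_apply, ← Fin.last_add_one m, add_left_inj]
  have apply_succ (k : Fin (m + 1)) (l : Fin m) : cyclicBidiagonal a b k l.succ =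
      (if k = l.succ then a k else 0) - if k = l.castSucc then b k else 0 := by
    simp only [cyclicBidiagonal, of_apply, ← Fin.coeSucc_eq_succ, add_left_inj]
  have minor_zero : ((cyclicBidiagonal a b).submatrix (Fin.succAbove 0) Fin.succ).det =
      ∏ k : Fin m, a k.succ := by
    rw [det_of_isUpperTriangular]
    · refine Finset.prod_congr rfl fun k _ => ?_
      simp [apply_succ, Fin.castSucc_lt_succ.ne']
    · intro k l hlk
      have := Fin.castSucc_lt_succ_iff.mpr (id hlk : l < k).le
      simp [apply_succ, (id hlk : l < k).ne', this.ne']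
  have minor_last : ((cyclicBidiagonal a b).submatrix (Fin.last m).succAbove Fin.succ).det =
      ∏ k : Fin m, -b k.castSucc := by
    rw [det_of_isLowerTriangular]
    · refine Finset.prod_congr rfl fun k _ => ?_
      simp [apply_succ, Fin.castSucc_lt_succ.ne]
    · intro k l hkl
      have hkl' : k < l := OrderDual.toDual_lt_toDual.mp hkl
      have := Fin.castSucc_lt_succ_iff.mpr hkl'.le
      simp [apply_succ, hkl'.ne, this.ne]
  rw [det_succ_column_zero]
  simp only [apply_zero, mul_sub, sub_mul, Finset.sum_sub_distrib, mul_ite, ite_mul, mul_zero,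
    zero_mul, Finset.sum_ite_eq', Finset.mem_univ, if_true, minor_zero, minor_last]
  rw [Fin.prod_univ_succ a, Fin.prod_univ_castSucc b, Finset.prod_neg]
  have hsign : ((-1) ^ m * (-1) ^ m : R) = 1 := by rw [← mul_pow]; simp
  simp only [Fin.val_zero, pow_zero, one_mul, Fin.val_last, Finset.card_univ, Fintype.card_fin]
  linear_combination (-(b (Fin.last m) * ∏ k : Fin m, b k.castSucc)) * hsign

end CyclicBidiagonal

section BlockTriangular

theorem det_comp_of_blockTriangular {R m n α : Type*} [CommRing R] [Fintype m] [Fintype n]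
    [DecidableEq m] [DecidableEq n] [LinearOrder α] {b : m → α} (hb : b.Injective)
    {M : Matrix m m (Matrix n n R)} (hM : M.BlockTriangular b) :
    (comp m m n n R M).det = ∏ i, (M i i).det := by
  let : LinearOrder m := LinearOrder.lift' b hb
  have hM' : M.BlockTriangular id := fun i j hij => hM hij
  rw [hM'.comp.det_fintype]
  refine Finset.prod_congr rfl fun i _ => ?_
  let e : n ≃ {p : m × n // p.1 = i} :=
    ⟨fun k => ⟨(i, k), rfl⟩, fun p => p.1.2, fun _ => rfl, by rintro ⟨⟨_, _⟩, rfl⟩; rfl⟩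
  exact (det_submatrix_equiv_self e _).symm

theorem blockTriangular_kronecker {R m n α β : Type*} [MulZeroClass R] [LinearOrder α]
    [LinearOrder β] {A : Matrix m m R} {B : Matrix n n R} {b : m → α} {c : n → β}
    (hA : A.BlockTriangular b) (hB : B.BlockTriangular c) :
    (A ⊗ₖ B).BlockTriangular fun p => toLex (b p.1, c p.2) := by
  rintro ⟨i, j⟩ ⟨i', j'⟩ h
  rw [kronecker_apply]
  obtain h | ⟨-, h⟩ := Prod.Lex.toLex_lt_toLex.mp h
  · rw [hA h, zero_mul]
  · rw [hB h, mul_zero]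

end BlockTriangular

section PeriodicSylvester

variable {R m n : Type*} [CommRing R] [Fintype m] [Fintype n] {r : ℕ} [NeZero r]

theorem bijective_mul_mul [DecidableEq m] [DecidableEq n] {U : Matrix m m R} {V : Matrix n n R}
    (hU : IsUnit U) (hV : IsUnit V) :
    Function.Bijective fun X : Matrix m n R => U * X * V := by
  rw [isUnit_iff_isUnit_det] at hU hV
  refine Function.bijective_iff_has_inverse.mpr ⟨fun X => U⁻¹ * X * V⁻¹, fun X => ?_, fun X => ?_⟩
  · simp [Matrix.mul_assoc, hU, hV]
  · simp [Matrix.mul_assoc, hU, hV]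

/-- The coefficient matrix of the cyclic system `F k *ᵥ y k - G k *ᵥ y (k + 1)`. The unknowns are
grouped by component rather than by `k`, so that the diagonal blocks are `cyclicBidiagonal`. -/
def blockCyclicBidiagonal {m : Type*} (F G : Fin r → Matrix m m R) :
    Matrix (m × Fin r) (m × Fin r) R :=
  comp m m (Fin r) (Fin r) R <|
    of fun p q => cyclicBidiagonal (fun k => F k p q) (fun k => G k p q)

theorem blockCyclicBidiagonal_mulVec_apply (F G : Fin r → Matrix m m R) (y : Fin r → m → R)
    (p : m) (k : Fin r) :
    (blockCyclicBidiagonal F G *ᵥ fun q => y q.2 q.1) (p, k) =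
      (F k *ᵥ y k - G k *ᵥ y (k + 1)) p := by
  have h := cyclicBidiagonal_mulVec_apply (R := R) (r := r)
  simp only [mulVec, dotProduct] at h
  simp [blockCyclicBidiagonal, mulVec, dotProduct, Fintype.sum_prod_type, h]

theorem det_blockCyclicBidiagonal [DecidableEq m] {α : Type*} [LinearOrder α] {b : m → α}
    (hb : b.Injective) {F G : Fin r → Matrix m m R} (hF : ∀ k, (F k).BlockTriangular b)
    (hG : ∀ k, (G k).BlockTriangular b) :
    (blockCyclicBidiagonal F G).det = ∏ p, (∏ k, F k p p - ∏ k, G k p p) := by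
  rw [blockCyclicBidiagonal, det_comp_of_blockTriangular hb]
  · simp only [of_apply, det_cyclicBidiagonal]
  · intro p q hpq
    ext k l
    simp [cyclicBidiagonal, hF _ hpq, hG _ hpq]

variable (A : Fin r → Matrix m m R) (B : Fin r → Matrix n n R)
  (C : Fin r → Matrix m m R) (D : Fin r → Matrix n n R)

/-- The operator whose value at `X` is the left-hand side of the periodic Sylvester system. -/
def periodicSylvesterMap (X : Fin r → Matrix m n R) : Fin r → Matrix m n R :=
  fun k => A k * X k * B k - C k * X (k + 1) * D k

/-- The matrix of `periodicSylvesterMap` in the coordinates `periodicVec`. -/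
def periodicSylvesterMatrix {m n : Type*} (A : Fin r → Matrix m m R) (B : Fin r → Matrix n n R)
    (C : Fin r → Matrix m m R) (D : Fin r → Matrix n n R) :
    Matrix ((n × m) × Fin r) ((n × m) × Fin r) R :=
  blockCyclicBidiagonal (fun k => (B k)ᵀ ⊗ₖ A k) (fun k => (D k)ᵀ ⊗ₖ C k)

/-- Coordinates on `r`-tuples of matrices: all columns are stacked as in `Matrix.vec`. -/
def periodicVec {m n : Type*} : (Fin r → Matrix m n R) ≃ ((n × m) × Fin r → R) where
  toFun X p := vec (X p.2) p.1
  invFun y k := of fun i j => y ((j, i), k)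

theorem periodicSylvesterMatrix_mulVec_periodicVec (X : Fin r → Matrix m n R) :
    periodicSylvesterMatrix A B C D *ᵥ periodicVec X =
      periodicVec (periodicSylvesterMap A B C D X) := by
  ext ⟨p, k⟩
  refine (blockCyclicBidiagonal_mulVec_apply _ _ (fun k => vec (X k)) p k).trans ?_
  simp only [kronecker_mulVec_vec, transpose_transpose, ← vec_sub]
  rfl

theorem bijective_periodicSylvesterMap_iff [DecidableEq m] [DecidableEq n] :
    Function.Bijective (periodicSylvesterMap A B C D) ↔
      IsUnit (periodicSylvesterMatrix A B C D).det := by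
  have h : (periodicSylvesterMatrix A B C D).mulVec ∘ periodicVec =
      periodicVec ∘ periodicSylvesterMap A B C D :=
    funext (periodicSylvesterMatrix_mulVec_periodicVec A B C D)
  rw [← Equiv.comp_bijective _ periodicVec, ← h, Equiv.bijective_comp, ← isUnit_iff_isUnit_det]
  exact ⟨fun h => mulVec_surjective_iff_isUnit.mp h.2,
    fun h => ⟨mulVec_injective_of_isUnit h, mulVec_surjective_iff_isUnit.mpr h⟩⟩

variable {A B C D} in
theorem det_periodicSylvesterMatrix [DecidableEq m] [DecidableEq n]
    {α β : Type*} [LinearOrder α] [LinearOrder β] {b : m → α} {c : n → β}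
    (hb : b.Injective) (hc : c.Injective)
    (hA : ∀ k, (A k).BlockTriangular b) (hB : ∀ k, (B k).BlockTriangular c)
    (hC : ∀ k, (C k).BlockTriangular b) (hD : ∀ k, (D k).BlockTriangular c) :
    (periodicSylvesterMatrix A B C D).det =
      ∏ j, ∏ i, ((∏ k, A k i i) * ∏ k, B k j j - (∏ k, C k i i) * ∏ k, D k j j) := by
  have hbc : Function.Injective fun p : n × m => toLex (OrderDual.toDual (c p.1), b p.2) :=
    toLex.injective.comp ((OrderDual.toDual.injective.comp hc).prodMap hb)
  rw [periodicSylvesterMatrix, det_blockCyclicBidiagonal hbc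
    (fun k => blockTriangular_kronecker (hB k).transpose (hA k))
    (fun k => blockTriangular_kronecker (hD k).transpose (hC k)), Fintype.prod_prod_type]
  simp only [kronecker_apply, transpose_apply, Finset.prod_mul_distrib, mul_comm]

theorem bijective_periodicSylvesterMap_mul_mul_iff [DecidableEq m] [DecidableEq n]
    {U V : Fin r → Matrix m m R} {S T : Fin r → Matrix n n R} (hU : ∀ k, IsUnit (U k))
    (hV : ∀ k, IsUnit (V k)) (hS : ∀ k, IsUnit (S k)) (hT : ∀ k, IsUnit (T k)) :
    Function.Bijective (periodicSylvesterMap (fun k => U k * A k * V k) (fun k => S k * B k * T k)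
        (fun k => U k * C k * V (k + 1)) (fun k => S (k + 1) * D k * T k)) ↔
      Function.Bijective (periodicSylvesterMap A B C D) := by
  have h : periodicSylvesterMap (fun k => U k * A k * V k) (fun k => S k * B k * T k)
      (fun k => U k * C k * V (k + 1)) (fun k => S (k + 1) * D k * T k) =
      Pi.map (fun k Y => U k * Y * T k) ∘ periodicSylvesterMap A B C D ∘
        Pi.map (fun k X => V k * X * S k) := by
    ext1 X
    ext1 k
    simp only [periodicSylvesterMap, Function.comp_apply, Pi.map_apply, Matrix.mul_assoc,
      Matrix.mul_sub, Matrix.sub_mul]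
  rw [h, Function.Bijective.of_comp_iff' (.piMap fun k => bijective_mul_mul (hU k) (hT k)),
    Function.Bijective.of_comp_iff _ (.piMap fun k => bijective_mul_mul (hV k) (hS k))]

end PeriodicSylvester

section Nonsingular

variable {r n : ℕ} [NeZero r] {A B C D : Fin r → Matrix (Fin n) (Fin n) ℂ}

theorem periodicSylvesterNonsingular_iff_bijective :
    PeriodicSylvesterNonsingular A B C D ↔ Function.Bijective (periodicSylvesterMap A B C D) := by
  simp only [Function.bijective_iff_existsUnique, funext_iff]
  rfl

theorem periodicSylvesterNonsingular_iff_of_blockTriangular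
    (hA : ∀ k, (A k).BlockTriangular id) (hB : ∀ k, (B k).BlockTriangular id)
    (hC : ∀ k, (C k).BlockTriangular id) (hD : ∀ k, (D k).BlockTriangular id) :
    PeriodicSylvesterNonsingular A B C D ↔
      ∀ i j, (∏ k, A k i i) * ∏ k, B k j j ≠ (∏ k, C k i i) * ∏ k, D k j j := by
  rw [periodicSylvesterNonsingular_iff_bijective, bijective_periodicSylvesterMap_iff,
    det_periodicSylvesterMatrix Function.injective_id Function.injective_id hA hB hC hD,
    forall_comm]
  simp only [isUnit_iff_ne_zero, Finset.prod_ne_zero_iff, Finset.mem_univ, true_imp_iff,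
    sub_ne_zero]

theorem periodicSylvesterNonsingular_iff_of_isPeriodicSchurForm
    {S U T R : Fin r → Matrix (Fin n) (Fin n) ℂ}
    (h₁ : (FormalProduct.invMul C A).IsPeriodicSchurForm S U)
    (h₂ : (FormalProduct.mulInv D B).IsPeriodicSchurForm T R) :
    PeriodicSylvesterNonsingular A B C D ↔
      ∀ i j, (∏ k, S k i i) * ∏ k, R k j j ≠ (∏ k, U k i i) * ∏ k, T k j j := by
  obtain ⟨Q, Z, hQ, hZ, hS, hU, hSt, hUt⟩ := h₁
  obtain ⟨P, W, hP, hW, hT, hR, hTt, hRt⟩ := h₂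
  have isUnit_of_unitary {X : Matrix (Fin n) (Fin n) ℂ} (hX : X ∈ unitaryGroup (Fin n) ℂ) :
      IsUnit X := Unitary.isUnit_coe (U := ⟨X, hX⟩)
  have isUnit_conjTranspose {X : Matrix (Fin n) (Fin n) ℂ} (hX : X ∈ unitaryGroup (Fin n) ℂ) :
      IsUnit Xᴴ := isUnit_of_unitary (Unitary.star_mem hX)
  have hS' : (fun k => (Q k)ᴴ * A k * Z k) = S := funext hS
  have hU' : (fun k => (Q k)ᴴ * C k * Z (k + 1)) = U := funext hU
  have hR' : (fun k => (P (k - 1))ᴴ * B k * W k) = fun k => R (k - 1) := by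
    funext k
    simp only [← hR, FormalProduct.mulInv, sub_add_cancel]
  have hT' : (fun k => (P (k + 1 - 1))ᴴ * D k * W k) = T := by
    funext k
    simp only [← hT, FormalProduct.mulInv, add_sub_cancel_right]
  have prod_sub_one (j : Fin n) : ∏ k, R (k - 1) j j = ∏ k, R k j j :=
    (Equiv.subRight 1).prod_comp fun k => R k j j
  -- The transformed unknowns are `(Z k)ᴴ * X k * P (k - 1)`.
  rw [periodicSylvesterNonsingular_iff_bijective, ← bijective_periodicSylvesterMap_mul_mul_iff
    A B C D (fun k => isUnit_conjTranspose (hQ k)) (fun k => isUnit_of_unitary (hZ k))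
    (fun k => isUnit_conjTranspose (hP (k - 1))) (fun k => isUnit_of_unitary (hW k)),
    hR', hT', hS', hU', ← periodicSylvesterNonsingular_iff_bijective,
    periodicSylvesterNonsingular_iff_of_blockTriangular hSt (fun k => hRt (k - 1)) hUt hTt]
  simp only [prod_sub_one]

end Nonsingular

theorem FormalProduct.ratio_eq_ratio_iff {a b c d : ℂ} (hab : ¬ (a = 0 ∧ b = 0))
    (hcd : ¬ (c = 0 ∧ d = 0)) : ratio a b = ratio c d ↔ a * d = b * c := by
  unfold ratio
  by_cases hb : b = 0 <;> by_cases hd : d = 0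
  · simp [hb, hd]
  · simp_all [OnePoint.infty_ne_coe]
  · simp_all [OnePoint.coe_ne_infty]
  · simp only [hb, hd, if_false, OnePoint.coe_eq_coe]
    rw [div_eq_div_iff hb hd, mul_comm c b]

theorem theorem4p1 {r n : ℕ} [NeZero r] (A B C D : Fin r → Matrix (Fin n) (Fin n) ℂ) :
    PeriodicSylvesterNonsingular A B C D ↔
      (FormalProduct.invMul C A).IsRegular ∧ (FormalProduct.mulInv D B).IsRegular ∧
        Disjoint (FormalProduct.invMul C A).spectrum (FormalProduct.mulInv D B).spectrum := by
  constructor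
  · intro h
    obtain ⟨S, U, h₁⟩ := (FormalProduct.invMul C A).exists_isPeriodicSchurForm
    obtain ⟨T, R, h₂⟩ := (FormalProduct.mulInv D B).exists_isPeriodicSchurForm
    have h' := (periodicSylvesterNonsingular_iff_of_isPeriodicSchurForm h₁ h₂).mp h
    refine ⟨⟨S, U, h₁, fun i hi => h' i i (by simp [hi])⟩,
      ⟨T, R, h₂, fun i hi => h' i i (by simp [hi])⟩, ?_⟩
    rw [Set.disjoint_left]
    rintro _ ⟨S, U, h₁, i, rfl⟩ ⟨T, R, h₂, j, hij⟩
    have h' := (periodicSylvesterNonsingular_iff_of_isPeriodicSchurForm h₁ h₂).mp h i j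
    exact h' ((FormalProduct.ratio_eq_ratio_iff (fun hi => h' (by simp [hi]))
      (fun hj => h' (by simp [hj]))).mp hij)
  · rintro ⟨⟨S, U, h₁, hSU⟩, ⟨T, R, h₂, hTR⟩, hdisj⟩
    rw [periodicSylvesterNonsingular_iff_of_isPeriodicSchurForm h₁ h₂]
    intro i j hij
    exact Set.disjoint_left.mp hdisj ⟨S, U, h₁, i, rfl⟩
      ⟨T, R, h₂, j, (FormalProduct.ratio_eq_ratio_iff (hSU i) (hTR j)).mpr hij⟩
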